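/- A word is a finite, possibly empty, sequence of letters from an arbitrary alphabet. A word $V$ is a factor of $W$ if $W=V_1VV_2$ for some (possibly empty) words $V_1,V_2$; $f_W(n)$ denotes the number of distinct factors of $W$ of length $n$. For a nonempty word $U=a_1\dots a_p$ and an integer $q\ge 0$, let $U^{q/p}=b_1\dots b_q$ be the word of length $q$ with $b_i=a_j$ whenever $i\equiv j\pmod p$. A word is an $\alpha$-power ($\alpha\in\mathbb{Q}$) if it equals $U^{q/p}$ for some nonempty word $U$ of length $p$ and some integer $q\ge 0$ with $q/p=\alpha$. For $d\in\mathbb{Q}$, a word avoids $d^+$-powers if none of its factors is an $\alpha$-power with $\alpha>d$. Let $W$ be a word of length $l$, and let $c(W)=\sum_{i=0}^{l}f_W(i)$ be its total complexity. 1. Let $d\in\mathbb{Q}$ be such that $W$ avoids $d^+$-powers, and let $k\ge 0$ be an integer with $k\le l/2$ and $l>kd$. Then $$c(W)\ \ge\ (k+1)(l-k+1).$$ 2. Let $d\ge 0$ be an integer such that $W$ avoids $d^+$-powers, and let $k\ge 0$ be an integer with $l>kd$ (the condition $k\le l/2$ is not required). Then again $c(W)\ge (k+1)(l-k+1)$.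 -/

import Mathlib

namespace FiniteWord

variable {A : Type*}

/-- The power `U ^ (q / p)` of a nonempty word `U = a₁ … a_p`: the word `b₁ … b_q` of length `q`
with `b_i = a_j` whenever `i ≡ j (mod p)` (written here with 0-based indices). -/
def ratPow (U : List A) (hU : U ≠ []) (q : ℕ) : List A :=
  List.ofFn fun i : Fin q =>
    U[(i : ℕ) % U.length]'(Nat.mod_lt _ (List.length_pos_of_ne_nil hU))

/-- `V` is an `α`-power: `V = U ^ α` for some nonempty word `U`, where the rational `α` is
represented by a fraction `q / p` whose denominator `p` is the length of `U`. -/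
def IsPower (α : ℚ) (V : List A) : Prop :=
  ∃ (U : List A) (hU : U ≠ []) (q : ℕ), α = (q : ℚ) / (U.length : ℚ) ∧ V = ratPow U hU q

/-- `W` avoids `d⁺`-powers: no factor of `W` is an `α`-power with `α > d`. -/
def AvoidsPlusPowers (d : ℚ) (W : List A) : Prop :=
  ∀ (α : ℚ) (V : List A), V <:+: W → d < α → ¬ IsPower α V

/-- The subword complexity `f_W(n)`: the number of distinct factors of `W` of length `n`. -/
noncomputable def complexity (W : List A) (n : ℕ) : ℕ :=
  {V : List A | V <:+: W ∧ V.length = n}.ncard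

/-- The total complexity `c(W) = ∑_{i=0}^{l} f_W(i)`, where `l` is the length of `W`. -/
noncomputable def totalComplexity (W : List A) : ℕ :=
  ∑ i ∈ Finset.range (W.length + 1), complexity W i

end FiniteWord

namespace FiniteWord

/-! It suffices that f_W(n) > min(n, l-n, k) for every n ≤ l; summing over n gives the bound. At the
first failure n = i+1, f_W(i+1) ≤ f_W(i). View W as a walk of l-i steps in the graph with the
factors of length i as vertices and those of length i+1 as edges. Fewer than l-i distinct edges
occur, so a vertex repeats, and having no more edges than vertices forces the shape path, cycle,
path (`exists_periodic_core`). Dropping a letters in front and b at the end leaves a factor of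
period p with a+b+p ≤ f_W(i+1) ≤ k, so its exponent (l-a-b)/p is at least l/k > d, a contradiction
(`min_lt_complexity`). -/

/-! ### Walks with no more edges than vertices. -/

/-- If `g` factors through `e` on `S`, then `g` takes at most as many values as `e`, and when
it takes as many, `e` factors through `g`. -/
theorem card_image_factor {ι α β : Type*} [DecidableEq α] [DecidableEq β]
    (S : Finset ι) (e : ι → β) (g : ι → α)
    (h : ∀ j ∈ S, ∀ k ∈ S, e j = e k → g j = g k) :
    (S.image g).card ≤ (S.image e).card ∧
      ((S.image e).card ≤ (S.image g).card → ∀ j ∈ S, ∀ k ∈ S, g j = g k → e j = e k) := by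
  classical
  rcases S.eq_empty_or_nonempty with rfl | ⟨s₀, hs₀⟩
  · simp
  let φ : β → α := fun b => if hb : ∃ j ∈ S, e j = b then g hb.choose else g s₀
  have hφ : ∀ j ∈ S, φ (e j) = g j := by
    intro j hj
    have hb : ∃ j' ∈ S, e j' = e j := ⟨j, hj, rfl⟩
    simp only [φ, dif_pos hb]
    exact h _ hb.choose_spec.1 _ hj hb.choose_spec.2
  have himg : (S.image e).image φ = S.image g := by
    rw [Finset.image_image]
    exact Finset.image_congr fun j hj => hφ j hj
  refine ⟨himg ▸ Finset.card_image_le, fun hle j hj k hk hjk => ?_⟩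
  have hinj : Set.InjOn φ (S.image e) :=
    Finset.card_image_iff.1 (le_antisymm Finset.card_image_le (by rw [himg]; exact hle))
  refine hinj (by simpa using ⟨j, hj, rfl⟩) (by simpa using ⟨k, hk, rfl⟩) ?_
  rw [hφ j hj, hφ k hk, hjk]

/-- A walk `x 0, …, x N` with edges `e 0, …, e (N - 1)` that visits some vertex twice and has no
more distinct edges than distinct vertices enters a cycle after `a` steps, runs around it, and
leaves it for good `b` steps before its end. -/
theorem exists_periodic_core {α β : Type*} [DecidableEq α] [DecidableEq β]
    (N : ℕ) (x : ℕ → α) (e : ℕ → β)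
    (hsrc : ∀ j k, e j = e k → x j = x k)
    (htgt : ∀ j k, e j = e k → x (j + 1) = x (k + 1))
    (hcard : ((Finset.range N).image e).card ≤ ((Finset.range (N + 1)).image x).card)
    (hrep : ¬ Set.InjOn x (Finset.range (N + 1) : Set ℕ)) :
    ∃ a b p : ℕ, 0 < p ∧ a + b + p ≤ ((Finset.range N).image e).card ∧ a + p + b ≤ N ∧
      (∀ j, a ≤ j → j + p + b ≤ N → x j = x (j + p)) ∧
      (∀ j, a ≤ j → j + p + b < N → e j = e (j + p)) := by
  classical
  let R : Finset ℕ := (Finset.range (N + 1)).filter fun j => ∃ k ≤ N, k ≠ j ∧ x k = x j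
  have memR : ∀ j, j ∈ R ↔ j ≤ N ∧ ∃ k ≤ N, k ≠ j ∧ x k = x j := by
    intro j; simp [R]
  have hRne : R.Nonempty := by
    simp only [Set.InjOn, not_forall] at hrep
    obtain ⟨j, hj, k, hk, hjk, hne⟩ := hrep
    simp only [Finset.coe_range, Set.mem_Iio] at hj hk
    exact ⟨j, (memR j).2 ⟨by omega, k, by omega, fun h => hne h.symm, hjk.symm⟩⟩
  obtain ⟨a, haR, hamin⟩ : ∃ a ∈ R, ∀ j ∈ R, a ≤ j :=
    ⟨R.min' hRne, R.min'_mem hRne, fun j hj => R.min'_le j hj⟩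
  obtain ⟨c, hcR, hcmax⟩ : ∃ c ∈ R, ∀ j ∈ R, j ≤ c :=
    ⟨R.max' hRne, R.max'_mem hRne, fun j hj => R.le_max' j hj⟩
  have partner : ∀ j ∈ R, ∃ k, a ≤ k ∧ k ≤ c ∧ k ≠ j ∧ x k = x j := by
    intro j hj
    obtain ⟨hjN, k, hk, hne, hx⟩ := (memR j).1 hj
    have hkR : k ∈ R := (memR k).2 ⟨hk, j, hjN, hne.symm, hx.symm⟩
    exact ⟨k, hamin k hkR, hcmax k hkR, hne, hx⟩
  obtain ⟨a', ha1, ha2, ha3, ha4⟩ := partner a haR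
  obtain ⟨c', hc1, hc2, hc3, hc4⟩ := partner c hcR
  have hcN : c ≤ N := ((memR c).1 hcR).1
  have unique : ∀ j k, j ≤ N → k ≤ N → x j = x k → (j < a ∨ c < j) → j = k := by
    intro j k hj hk hx hout
    by_contra hne
    have hjR : j ∈ R := (memR j).2 ⟨hj, k, hk, fun h => hne h.symm, hx.symm⟩
    have h1 := hamin j hjR
    have h2 := hcmax j hjR
    omega
  let S := Finset.Ico a c
  let T := Finset.range a ∪ Finset.Ico c N
  have memT : ∀ j, j ∈ T ↔ j < a ∨ (c ≤ j ∧ j < N) := by intro j; simp [T]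
  have uniqueE : ∀ j ∈ T, ∀ k < N, e j = e k → j = k := by
    intro j hj k hk hjk
    rcases (memT j).1 hj with h | h
    · exact unique j k (by omega) (by omega) (hsrc _ _ hjk) (Or.inl h)
    · have := unique (j + 1) (k + 1) (by omega) (by omega) (htgt _ _ hjk) (Or.inr (by omega))
      omega
  have hTlt : ∀ j ∈ T, j < N := by intro j hj; have := (memT j).1 hj; omega
  have hTcard : T.card = a + (N - c) := by
    rw [Finset.card_union_of_disjoint, Finset.card_range, Nat.card_Ico]
    rw [Finset.disjoint_left]
    intro j hj hj'
    simp only [Finset.mem_range, Finset.mem_Ico] at hj hj'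
    omega
  have hE : ((Finset.range N).image e).card = a + (N - c) + (S.image e).card := by
    have hsplit : Finset.range N = T ∪ S := by
      ext j
      simp only [T, S, Finset.mem_union, Finset.mem_range, Finset.mem_Ico]
      omega
    rw [hsplit, Finset.image_union, Finset.card_union_of_disjoint, Finset.card_image_of_injOn,
      hTcard]
    · intro j hj k hk hjk
      exact uniqueE j hj k (hTlt k hk) hjk
    · rw [Finset.disjoint_left]
      intro y hy hy'
      obtain ⟨j, hj, rfl⟩ := Finset.mem_image.1 hy
      obtain ⟨k, hk, hkj⟩ := Finset.mem_image.1 hy'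
      have hk' := Finset.mem_Ico.1 hk
      have hjk := uniqueE j hj k (by omega) hkj.symm
      have := (memT j).1 hj
      omega
  -- Every vertex on the stretch from `a` to `c` is both a source and a target of an edge there: the
  -- endpoints `c` and `a` are revisited inside, at `c'` and `a'`.
  have himS : (Finset.Icc a c).image x ⊆ S.image x := by
    intro y hy
    obtain ⟨j, hj, rfl⟩ := Finset.mem_image.1 hy
    have hj' := Finset.mem_Icc.1 hj
    rcases hj'.2.lt_or_eq with h | h
    · exact Finset.mem_image_of_mem x (Finset.mem_Ico.2 ⟨hj'.1, h⟩)
    · subst h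
      exact Finset.mem_image.2 ⟨c', Finset.mem_Ico.2 ⟨hc1, by omega⟩, hc4⟩
  have himS' : (Finset.Icc a c).image x ⊆ S.image fun j => x (j + 1) := by
    intro y hy
    obtain ⟨j, hj, rfl⟩ := Finset.mem_image.1 hy
    have hj' := Finset.mem_Icc.1 hj
    rcases hj'.1.lt_or_eq with h | h
    · refine Finset.mem_image.2 ⟨j - 1, Finset.mem_Ico.2 ⟨by omega, by omega⟩, ?_⟩
      show x (j - 1 + 1) = x j
      rw [Nat.sub_add_cancel (by omega)]
    · subst h
      refine Finset.mem_image.2 ⟨a' - 1, Finset.mem_Ico.2 ⟨by omega, by omega⟩, ?_⟩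
      show x (a' - 1 + 1) = x a
      rw [Nat.sub_add_cancel (by omega), ha4]
  have hV : ((Finset.range (N + 1)).image x).card ≤
      a + (N - c) + ((Finset.Icc a c).image x).card := by
    have hsplit : Finset.range (N + 1) =
        (Finset.range a ∪ Finset.Ioc c N) ∪ Finset.Icc a c := by
      ext j
      simp only [Finset.mem_union, Finset.mem_range, Finset.mem_Ioc, Finset.mem_Icc]
      omega
    rw [hsplit, Finset.image_union]
    refine (Finset.card_union_le _ _).trans (Nat.add_le_add_right ?_ _)
    refine Finset.card_image_le.trans ((Finset.card_union_le _ _).trans ?_)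
    rw [Finset.card_range, Nat.card_Ioc]
  -- Outside the stretch edges are never repeated, so the global count passes to it. Then vertex and
  -- edge determine each other, both forwards (`hfwd`) and backwards (`hbwd`).
  have hle : (S.image e).card ≤ ((Finset.Icc a c).image x).card := by omega
  obtain ⟨hVE, hfwd⟩ := card_image_factor S e x fun j _ k _ h => hsrc j k h
  obtain ⟨-, hbwd⟩ := card_image_factor S e (fun j => x (j + 1)) fun j _ k _ h => htgt j k h
  replace hfwd := hfwd (hle.trans (Finset.card_le_card himS))
  replace hbwd := hbwd (hle.trans (Finset.card_le_card himS'))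
  have hMc : (S.image x).card ≤ c - a := Finset.card_image_le.trans (by simp [S])
  obtain ⟨s, t, hs, hst, htM, hxst⟩ :
      ∃ s t, a ≤ s ∧ s < t ∧ t ≤ a + (S.image x).card ∧ x s = x t := by
    obtain ⟨s, hs, t, ht, hne, hx⟩ := Finset.exists_ne_map_eq_of_card_lt_of_maps_to
      (s := Finset.Icc a (a + (S.image x).card)) (t := S.image x) (f := x)
      (by rw [Nat.card_Icc]; omega)
      (by
        intro j hj
        have hj' := Finset.mem_Icc.1 hj
        exact himS (Finset.mem_image_of_mem x (Finset.mem_Icc.2 ⟨hj'.1, by omega⟩)))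
    have hs' := Finset.mem_Icc.1 hs
    have ht' := Finset.mem_Icc.1 ht
    rcases hne.lt_or_gt with h | h
    · exact ⟨s, t, hs'.1, h, ht'.2, hx⟩
    · exact ⟨t, s, ht'.1, h, hs'.2, hx.symm⟩
  have memS : ∀ j, a ≤ j → j < c → j ∈ S := fun j h1 h2 => Finset.mem_Ico.2 ⟨h1, h2⟩
  -- Running both walks backwards moves the coincidence to `a`, so the periodicity starts there.
  have back : ∀ r, a + r ≤ s → x (s - r) = x (t - r) := by
    intro r
    induction r with
    | zero => intro _; exact hxst
    | succ r ih =>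
      intro hr
      refine hsrc _ _ (hbwd _ (memS _ (by omega) (by omega)) _ (memS _ (by omega) (by omega)) ?_)
      have h1 : s - (r + 1) + 1 = s - r := by omega
      have h2 : t - (r + 1) + 1 = t - r := by omega
      show x (s - (r + 1) + 1) = x (t - (r + 1) + 1)
      rw [h1, h2]
      exact ih (by omega)
  have hperiod : ∀ r, a + r + (t - s) ≤ c → x (a + r) = x (a + r + (t - s)) := by
    intro r
    induction r with
    | zero =>
      intro _
      have h := back (s - a) (by omega)
      have h1 : s - (s - a) = a + 0 := by omega
      have h2 : t - (s - a) = a + 0 + (t - s) := by omega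
      rwa [h1, h2] at h
    | succ r ih =>
      intro hr
      have h := htgt _ _ (hfwd _ (memS (a + r) (by omega) (by omega)) _
        (memS (a + r + (t - s)) (by omega) (by omega)) (ih (by omega)))
      have h2 : a + (r + 1) + (t - s) = a + r + (t - s) + 1 := by omega
      rw [h2]
      exact h
  have hper : ∀ j, a ≤ j → j + (t - s) + (N - c) ≤ N → x j = x (j + (t - s)) := by
    intro j hj hjN
    obtain ⟨r, rfl⟩ := Nat.exists_eq_add_of_le hj
    exact hperiod r (by omega)
  refine ⟨a, N - c, t - s, by omega, by omega, by omega, hper, fun j hj hjN => ?_⟩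
  exact hfwd _ (memS _ hj (by omega)) _ (memS _ (by omega) (by omega)) (hper j hj (by omega))

/-! ### Factors, periods and exponents. -/

/-- The factor of `W` of length `n` starting at position `j` (shorter if `W` ends before). -/
def window {A : Type*} (W : List A) (n j : ℕ) : List A := (W.drop j).take n

theorem window_getElem? {A : Type*} (W : List A) {n j r : ℕ} (hr : r < n) :
    (window W n j)[r]? = W[j + r]? := by
  rw [window, List.getElem?_take_of_lt hr, List.getElem?_drop]

theorem window_take {A : Type*} (W : List A) (n j : ℕ) :
    (window W (n + 1) j).take n = window W n j := by
  simp [window, List.take_take]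

theorem window_tail {A : Type*} (W : List A) (n j : ℕ) :
    (window W (n + 1) j).drop 1 = window W n (j + 1) := by
  simp [window, List.drop_take]

theorem window_isInfix {A : Type*} (W : List A) (n j : ℕ) : window W n j <:+: W :=
  (List.take_prefix _ _).isInfix.trans (List.drop_suffix _ _).isInfix

theorem complexity_eq_card {A : Type*} [DecidableEq A] (W : List A) {n : ℕ} (hn : n ≤ W.length) :
    complexity W n = ((Finset.range (W.length - n + 1)).image (window W n)).card := by
  rw [complexity, ← Set.ncard_coe_finset]
  congr 1
  ext V
  simp only [Set.mem_ofPred_eq, Finset.coe_image, Finset.coe_range, Set.mem_image, Set.mem_Iio]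
  constructor
  · rintro ⟨⟨s, t, rfl⟩, rfl⟩
    refine ⟨s.length, ?_, ?_⟩
    · simp only [List.length_append]; omega
    · simp [window]
  · rintro ⟨j, hj, rfl⟩
    refine ⟨window_isInfix W n j, ?_⟩
    simp only [window, List.length_take, List.length_drop]
    omega

theorem exponent_le_of_period {A : Type*} {W : List A} {d : ℚ} (hW : AvoidsPlusPowers d W)
    {a b p : ℕ} (hp : 0 < p) (hlen : a + p + b ≤ W.length)
    (hper : ∀ j, a ≤ j → j + p + b < W.length → W[j]? = W[j + p]?) :
    ((W.length - a - b : ℕ) : ℚ) / p ≤ d := by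
  by_contra! hlt
  have hUlen : (window W p a).length = p := by
    simp only [window, List.length_take, List.length_drop]; omega
  have hU : window W p a ≠ [] := List.ne_nil_of_length_pos (by omega)
  refine hW _ (window W (W.length - a - b) a) (window_isInfix W _ a) hlt
    ⟨window W p a, hU, W.length - a - b, by rw [hUlen], ?_⟩
  have key : ∀ m r, r + m * p + a + b < W.length → W[a + r]? = W[a + r + m * p]? := by
    intro m
    induction m with
    | zero => intro r _; simp
    | succ m ih =>
      intro r hr
      rw [Nat.succ_mul] at hr ⊢
      rw [ih r (by omega), hper _ (by omega) (by omega), Nat.add_assoc (a + r)]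
  have hVlen : (window W (W.length - a - b) a).length = W.length - a - b := by
    simp only [window, List.length_take, List.length_drop]; omega
  apply List.ext_getElem?
  intro r
  by_cases hr : r < W.length - a - b
  · rw [window_getElem? W hr, ratPow, List.getElem?_ofFn, dif_pos hr]
    have hmod : r % p < p := Nat.mod_lt _ hp
    have hdiv : r % p + r / p * p = r := by rw [Nat.mul_comm]; exact Nat.mod_add_div r p
    rw [← List.getElem?_eq_getElem]
    simp only [hUlen]
    rw [window_getElem? W hmod, key (r / p) (r % p) (by omega), Nat.add_assoc, hdiv]
  · rw [List.getElem?_eq_none (by omega), List.getElem?_eq_none (by simp [ratPow]; omega)]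

theorem min_lt_complexity {A : Type*} {W : List A} {d : ℚ} {k : ℕ} (hW : AvoidsPlusPowers d W)
    (hk : k ≤ W.length) (hkd : (k : ℚ) * d < W.length) :
    ∀ n ≤ W.length, min n (min (W.length - n) k) < complexity W n := by
  classical
  intro n
  induction n with
  | zero =>
    intro hn
    rw [complexity_eq_card W hn]
    simp
  | succ i ih =>
    intro hn
    have hi := ih (by omega)
    by_contra! hbad
    have hV := complexity_eq_card W (show i ≤ W.length by omega)
    have hE := complexity_eq_card W hn
    have hN : W.length - (i + 1) + 1 = W.length - i := by omega
    rw [hN] at hE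
    have hsrc : ∀ j k, window W (i + 1) j = window W (i + 1) k → window W i j = window W i k := by
      intro j k h
      rw [← window_take, h, window_take]
    obtain ⟨a, b, p, hp, hsum, hlen, hx, he⟩ := exists_periodic_core (W.length - i)
      (window W i) (window W (i + 1)) hsrc
      (fun j k h => by rw [← window_tail, h, window_tail])
      (by omega)
      (by
        intro hinj
        have : ((Finset.range (W.length - i)).image (window W (i + 1))).card
            = W.length - i := by
          rw [Finset.card_image_of_injOn, Finset.card_range]
          intro j hj k hk hjk
          simp only [Finset.coe_range, Set.mem_Iio] at hj hk
          exact hinj (by simp; omega) (by simp; omega) (hsrc j k hjk)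
        omega)
    have hexp := exponent_le_of_period hW hp (a := a) (b := b) (by omega) (by
      intro j hj hjl
      by_cases hjN : j + p + b < W.length - i
      · have h := congrArg (fun V => V[0]?) (he j hj hjN)
        simpa [window_getElem? W (Nat.succ_pos i)] using h
      -- Past the last periodic edge, the letters are read off inside the last pair of equal
      -- vertices.
      · obtain ⟨r, hr⟩ : ∃ r, j = (W.length - i - b - p) + r :=
          Nat.exists_eq_add_of_le (by omega)
        have hri : r < i := by omega
        have h := congrArg (fun V => V[r]?)
          (hx (W.length - i - b - p) (by omega) (by omega))
        simp only [window_getElem? W hri] at h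
        rw [hr, h]
        congr 1
        omega)
    have hpk : a + b + p ≤ k := by omega
    have hp' : (0 : ℚ) < p := by exact_mod_cast hp
    have hk' : (0 : ℚ) < k := by exact_mod_cast (show 0 < k by omega)
    -- With s = a+b, (p+s)(l-s) - pl = s(l-s-p) ≥ 0, since p+s ≤ k ≤ l.
    have hnat : p * W.length ≤ k * (W.length - a - b) := by
      obtain ⟨u, hu⟩ := Nat.exists_eq_add_of_le hpk
      obtain ⟨v, hv⟩ := Nat.exists_eq_add_of_le hk
      have hq : W.length - a - b = p + u + v := by omega
      rw [hq, hv, hu]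
      nlinarith [Nat.zero_le (a * u), Nat.zero_le (a * v), Nat.zero_le (b * u),
        Nat.zero_le (b * v), Nat.zero_le (u * u), Nat.zero_le (u * v), Nat.zero_le (p * u)]
    have hrat : (p : ℚ) * W.length ≤ k * (W.length - a - b : ℕ) := by exact_mod_cast hnat
    rw [div_le_iff₀ hp'] at hexp
    have h1 := mul_le_mul_of_nonneg_left hexp hk'.le
    have h2 := mul_lt_mul_of_pos_left hkd hp'
    linarith

/-! ### Summation and the theorem. -/

theorem sum_min (l k : ℕ) (hk : 2 * k ≤ l) :
    ∑ n ∈ Finset.range (l + 1), (min n (min (l - n) k) + 1) = (k + 1) * (l - k + 1) := by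
  obtain ⟨m, rfl⟩ := Nat.exists_eq_add_of_le hk
  have hsplit : 2 * k + m + 1 = k + (m + 1) + k := by omega
  rw [hsplit, Finset.sum_range_add, Finset.sum_range_add]
  have h1 : ∑ n ∈ Finset.range k, (min n (min (2 * k + m - n) k) + 1)
      = ∑ n ∈ Finset.range k, (n + 1) := by
    refine Finset.sum_congr rfl fun n hn => ?_
    rw [Finset.mem_range] at hn
    omega
  have h2 : ∑ n ∈ Finset.range (m + 1), (min (k + n) (min (2 * k + m - (k + n)) k) + 1)
      = (m + 1) * (k + 1) := by
    rw [Finset.sum_congr rfl (g := fun _ => k + 1)]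
    · simp
    · intro n hn
      rw [Finset.mem_range] at hn
      omega
  have h3 : ∑ n ∈ Finset.range k,
      (min (k + (m + 1) + n) (min (2 * k + m - (k + (m + 1) + n)) k) + 1)
      = ∑ n ∈ Finset.range k, (n + 1) := by
    rw [← Finset.sum_range_reflect (fun n => n + 1) k]
    refine Finset.sum_congr rfl fun n hn => ?_
    rw [Finset.mem_range] at hn
    omega
  have hgauss : 2 * ∑ n ∈ Finset.range k, (n + 1) = k * (k + 1) := by
    clear hk hsplit h1 h2 h3
    induction k with
    | zero => simp
    | succ k ih => rw [Finset.sum_range_succ, Nat.mul_add, ih]; ring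
  rw [h1, h2, h3]
  have hsub : 2 * k + m - k + 1 = k + m + 1 := by omega
  rw [hsub]
  linarith

theorem le_totalComplexity {A : Type*} {W : List A} {d : ℚ} {k : ℕ} (hW : AvoidsPlusPowers d W)
    (hk : 2 * k ≤ W.length) (hkd : (k : ℚ) * d < W.length) :
    (k + 1) * (W.length - k + 1) ≤ totalComplexity W := by
  rw [← sum_min W.length k hk, totalComplexity]
  refine Finset.sum_le_sum fun n hn => ?_
  exact min_lt_complexity hW (by omega) hkd n (by simpa [Nat.lt_succ_iff] using hn)

end FiniteWord

theorem theorem5p4 {A : Type*} (W : List A) (l : ℕ) (hl : W.length = l) :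
    (∀ (d : ℚ) (k : ℕ), FiniteWord.AvoidsPlusPowers d W →
      (k : ℚ) ≤ (l : ℚ) / 2 → (k : ℚ) * d < (l : ℚ) →
      ((k : ℤ) + 1) * ((l : ℤ) - (k : ℤ) + 1) ≤ (FiniteWord.totalComplexity W : ℤ)) ∧
    (∀ d k : ℕ, FiniteWord.AvoidsPlusPowers (d : ℚ) W → k * d < l →
      ((k : ℤ) + 1) * ((l : ℤ) - (k : ℤ) + 1) ≤ (FiniteWord.totalComplexity W : ℤ)) := by
  subst hl
  have main : ∀ (d : ℚ) (k : ℕ), FiniteWord.AvoidsPlusPowers d W → 2 * k ≤ W.length →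
      (k : ℚ) * d < W.length →
      ((k : ℤ) + 1) * ((W.length : ℤ) - (k : ℤ) + 1) ≤ (FiniteWord.totalComplexity W : ℤ) := by
    intro d k hW hk hkd
    have h := FiniteWord.le_totalComplexity hW hk hkd
    zify [show k ≤ W.length by omega] at h
    exact h
  refine ⟨fun d k hW hk hkd => main d k hW ?_ hkd, fun d k hW hkd => ?_⟩
  · have : (2 * k : ℚ) ≤ W.length := by linarith
    exact_mod_cast this
  · by_cases hk : 2 * k ≤ W.length
    · exact main d k hW hk (by exact_mod_cast hkd)
    -- Here k > l/2 forces d < 2, and a single letter is a 1-power, which excludes d = 0.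
    · have hd : d ≠ 0 := by
        rintro rfl
        have h := FiniteWord.exponent_le_of_period hW (a := 0) (b := W.length - 1) (p := 1)
          one_pos (by omega) (fun j _ hj => by omega)
        have h1 : W.length - 0 - (W.length - 1) = 1 := by omega
        rw [h1] at h
        norm_num at h
      have hd1 : d = 1 := by
        by_contra hne
        have : k * 2 ≤ k * d := Nat.mul_le_mul_left k (by omega)
        omega
      subst hd1
      have hkl : k ≤ W.length := by omega
      -- The bound is symmetric under k ↦ l-k, and l-k ≤ l/2.
      have h := main 1 (W.length - k) (by exact_mod_cast hW) (by omega)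
        (by rw [mul_one]; exact_mod_cast (show W.length - k < W.length by omega))
      push_cast [hkl] at h
      linarith
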